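/- Let $K$ be a field and let $E=(E^0,E^1,r,s)$ be a directed graph with $E^0\neq\emptyset$, where $E^0$ is the set of vertices, $E^1$ the set of edges, and $s,r:E^1\to E^0$ are the source and range maps. Let $L_K(E)$ be the Leavitt path algebra of $E$ with coefficients in $K$, i.e. the (associative, not necessarily unital) $K$-algebra generated by a set $\{v\mid v\in E^0\}$ of pairwise orthogonal idempotents together with variables $\{f\mid f\in E^1\}\cup\{f^*\mid f\in E^1\}$, subject to the relations 1. $s(f)f=fr(f)=f$ for all $f\in E^1$; 2. $r(f)f^*=f^*s(f)=f^*$ for all $f\in E^1$; 3. $f^*f'=\delta_{f,f'}\,r(f)$ for all $f,f'\in E^1$; 4. $v=\sum_{f\in E^1,\ s(f)=v} ff^*$ for every $v\in E^0$ for which $s^{-1}(v)$ is non-empty and finite. Call $E$ finite if $E^0$ and $E^1$ are finite. Call $E$ acyclic if it has no cycle, a cycle being a sequence of edges $\mu_1\cdots\mu_n$ ($n\ge 1$) with $r(\mu_i)=s(\mu_{i+1})$ for $1\le i<n$, $r(\mu_n)=s(\mu_1)$ and $s(\mu_i)\ne s(\mu_j)$ for $i\neq j$. A ring is left (right) artinian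 if it satisfies the descending chain condition on left (right) ideals, and artinian if it is both left and right artinian. A ring is unital if it has a non-zero multiplicative identity, and a unital ring is semisimple if it is a direct sum of simple left ideals, i.e. semisimple as a left module over itself. Then the following five assertions are equivalent: - (i) $E$ is finite and acyclic; - (ii) $L_K(E)$ is left artinian; - (iii) $L_K(E)$ is right artinian; - (iv) $L_K(E)$ is artinian; - (v) $L_K(E)$ is unital and semisimple. -/

import Mathlib

universe u v w

/-- A directed graph with vertex set `V` and edge set `A` (loops and parallel edges allowed),
given by its source map `s` and its range map `r`. -/
structure DirectedGraph (V : Type u) (A : Type v) where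
  s : A → V
  r : A → V

namespace DirectedGraph

variable {V : Type u} {A : Type v} (E : DirectedGraph V A)

/-- A path of positive length: a nonempty sequence of consecutive edges. -/
def IsPath (p : List A) : Prop :=
  p ≠ [] ∧ p.IsChain (fun e f => E.r e = E.s f)

/-- A cycle: a path of positive length that ends where it starts and whose edges have pairwise
distinct sources. -/
def IsCycle (p : List A) : Prop :=
  E.IsPath p ∧ (∃ h : p ≠ [], E.s (p.head h) = E.r (p.getLast h)) ∧ (p.map E.s).Nodup

/-- A graph without cycles. -/
def IsAcyclic : Prop := ∀ p : List A, ¬ E.IsCycle p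

end DirectedGraph

namespace LeavittPathAlgebra

/-- The generators `v`, `f`, `f*` of the Leavitt path algebra. -/
inductive Gen (V : Type u) (A : Type v) : Type (max u v)
  | vertex (v : V)
  | edge (f : A)
  | ghost (f : A)

/-- The free associative (non-unital) `K`-algebra on the generators: the semigroup algebra of the
free semigroup. -/
abbrev Free (K : Type w) [Field K] (V : Type u) (A : Type v) : Type (max u v w) :=
  MonoidAlgebra K (FreeSemigroup (Gen V A))

variable {K : Type w} [Field K] {V : Type u} {A : Type v}

/-- A generator as an element of the free algebra. -/
noncomputable def gen (K : Type w) [Field K] (x : Gen V A) : Free K V A :=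
  MonoidAlgebra.single (FreeSemigroup.of x) (1 : K)

open Gen in
/-- The defining relations of the Leavitt path algebra. -/
inductive Rel (K : Type w) [Field K] (E : DirectedGraph V A) : Free K V A → Free K V A → Prop
  | idem (v : V) : Rel K E (gen K (vertex v) * gen K (vertex v)) (gen K (vertex v))
  | orth (v w : V) : v ≠ w → Rel K E (gen K (vertex v) * gen K (vertex w)) 0
  | source_edge (f : A) : Rel K E (gen K (vertex (E.s f)) * gen K (edge f)) (gen K (edge f))
  | edge_range (f : A) : Rel K E (gen K (edge f) * gen K (vertex (E.r f))) (gen K (edge f))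
  | range_ghost (f : A) : Rel K E (gen K (vertex (E.r f)) * gen K (ghost f)) (gen K (ghost f))
  | ghost_source (f : A) : Rel K E (gen K (ghost f) * gen K (vertex (E.s f))) (gen K (ghost f))
  | ghost_edge_self (f : A) :
      Rel K E (gen K (ghost f) * gen K (edge f)) (gen K (vertex (E.r f)))
  | ghost_edge_ne (f g : A) : f ≠ g → Rel K E (gen K (ghost f) * gen K (edge g)) 0
  | sum_edges (v : V) (hfin : {f : A | E.s f = v}.Finite) (hne : {f : A | E.s f = v}.Nonempty) :
      Rel K E (gen K (vertex v)) (∑ f ∈ hfin.toFinset, gen K (edge f) * gen K (ghost f))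

/-- The smallest `K`-linear ring congruence that contains the defining relations. (Scalar
multiples of the relations are put in because the free algebra has no identity.) -/
noncomputable def con (K : Type w) [Field K] (E : DirectedGraph V A) : RingCon (Free K V A) :=
  ringConGen fun a b => ∃ (k : K) (x y : Free K V A), Rel K E x y ∧ a = k • x ∧ b = k • y

theorem con_smul (E : DirectedGraph V A) (k : K) {a b : Free K V A} (h : con K E a b) :
    con K E (k • a) (k • b) := by
  change RingConGen.Rel _ a b at h
  change RingConGen.Rel _ (k • a) (k • b)
  induction h with
  | of x y h =>
    obtain ⟨l, x, y, h, rfl, rfl⟩ := h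
    exact .of _ _ ⟨k * l, x, y, h, smul_smul k l x, smul_smul k l y⟩
  | refl x => exact .refl _
  | symm _ ih => exact .symm ih
  | trans _ _ ih ih' => exact .trans ih ih'
  | add _ _ ih ih' =>
    rw [smul_add, smul_add]
    exact .add ih ih'
  | mul _ h' ih _ =>
    rw [← smul_mul_assoc, ← smul_mul_assoc]
    exact .mul ih h'

end LeavittPathAlgebra

/-- The Leavitt path algebra `L_K(E)`: the associative, not necessarily unital, `K`-algebra with
generators `v`, `f`, `f*` (`v` a vertex, `f` an edge) and the defining relations above. -/
def LeavittPathAlgebra (K : Type w) [Field K] {V : Type u} {A : Type v}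
    (E : DirectedGraph V A) : Type (max u v w) :=
  (LeavittPathAlgebra.con K E).Quotient

namespace LeavittPathAlgebra

variable {K : Type w} [Field K] {V : Type u} {A : Type v} (E : DirectedGraph V A)

noncomputable instance : NonUnitalRing (LeavittPathAlgebra K E) :=
  inferInstanceAs (NonUnitalRing (con K E).Quotient)

variable (K) in
/-- The quotient map from the free algebra. -/
noncomputable def mk (a : Free K V A) : LeavittPathAlgebra K E := (a : (con K E).Quotient)

noncomputable instance : SMul K (LeavittPathAlgebra K E) where
  smul k := Quotient.map' (s₁ := (con K E).toSetoid) (s₂ := (con K E).toSetoid)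
    (fun a => k • a) (fun _ _ h => con_smul E k h)

theorem mk_surjective : Function.Surjective (mk K E) := Quotient.exists_rep

noncomputable instance : Module K (LeavittPathAlgebra K E) where
  one_smul x := by
    obtain ⟨a, rfl⟩ := mk_surjective E x
    exact congrArg (mk K E) (one_smul K a)
  mul_smul k l x := by
    obtain ⟨a, rfl⟩ := mk_surjective E x
    exact congrArg (mk K E) (mul_smul k l a)
  smul_zero k := congrArg (mk K E) (smul_zero k)
  smul_add k x y := by
    obtain ⟨a, rfl⟩ := mk_surjective E x
    obtain ⟨b, rfl⟩ := mk_surjective E y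
    exact congrArg (mk K E) (smul_add k a b)
  add_smul k l x := by
    obtain ⟨a, rfl⟩ := mk_surjective E x
    exact congrArg (mk K E) (add_smul k l a)
  zero_smul x := by
    obtain ⟨a, rfl⟩ := mk_surjective E x
    exact congrArg (mk K E) (zero_smul K a)

instance : IsScalarTower K (LeavittPathAlgebra K E) (LeavittPathAlgebra K E) where
  smul_assoc k x y := by
    obtain ⟨a, rfl⟩ := mk_surjective E x
    obtain ⟨b, rfl⟩ := mk_surjective E y
    exact congrArg (mk K E) (smul_mul_assoc k a b)

instance : SMulCommClass K (LeavittPathAlgebra K E) (LeavittPathAlgebra K E) where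
  smul_comm k x y := by
    obtain ⟨a, rfl⟩ := mk_surjective E x
    obtain ⟨b, rfl⟩ := mk_surjective E y
    exact congrArg (mk K E) (mul_smul_comm k a b).symm

end LeavittPathAlgebra

/-! Chain conditions and semisimplicity for associative rings that need not have an identity. -/

namespace NonUnitalRing

variable (R : Type u) [NonUnitalRing R]

/-- A left ideal: an additive subgroup closed under left multiplication by the ring. -/
def IsLeftIdeal (I : AddSubgroup R) : Prop := ∀ a : R, ∀ x ∈ I, a * x ∈ I

/-- A right ideal: an additive subgroup closed under right multiplication by the ring. -/
def IsRightIdeal (I : AddSubgroup R) : Prop := ∀ a : R, ∀ x ∈ I, x * a ∈ I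

/-- The descending chain condition on left ideals. -/
def IsLeftArtinian : Prop :=
  ∀ I : ℕ → AddSubgroup R, (∀ n, IsLeftIdeal R (I n)) → Antitone I →
    ∃ n, ∀ m, n ≤ m → I m = I n

/-- The descending chain condition on right ideals. -/
def IsRightArtinian : Prop :=
  ∀ I : ℕ → AddSubgroup R, (∀ n, IsRightIdeal R (I n)) → Antitone I →
    ∃ n, ∀ m, n ≤ m → I m = I n

/-- Both left and right artinian. -/
def IsArtinian : Prop := IsLeftArtinian R ∧ IsRightArtinian R

variable {R}

/-- `e` is a two-sided multiplicative identity. -/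
structure IsIdentity (e : R) : Prop where
  one_mul : ∀ a : R, e * a = a
  mul_one : ∀ a : R, a * e = a

/-- The ring with identity that a ring `R` with an identity element `e` is. -/
abbrev IsIdentity.ring {e : R} (h : IsIdentity e) : Ring R :=
  { ‹NonUnitalRing R› with
    one := e
    one_mul := h.one_mul
    mul_one := h.mul_one }

variable (R) in
/-- `R` has an identity element, which is nonzero, and is a semisimple ring (it is a semisimple
left module over itself). -/
def IsUnitalSemisimple : Prop :=
  ∃ (e : R) (h : IsIdentity e), e ≠ 0 ∧ @IsSemisimpleRing R h.ring

end NonUnitalRing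

/-! Let `E` be finite and acyclic. The sum of the vertices is an identity. A sink `w` generates a
minimal left ideal: this ideal is spanned by paths ending at `w`, and a nonzero `y * w` can be
pushed along ghost edges down to a sink, where only a nonzero multiple of `w` is left
(`isLeftMinimal_sink`). A vertex that is not a sink is a sum of `f f* = f r(f) f*`, so by induction
along the edges every vertex lies in the two-sided socle (`vertex_mem_socle`). Hence `1` does too,
and the ring is semisimple, therefore artinian on both sides.

Conversely, vertices are nonzero orthogonal idempotents and `f* g = δ r(f)`. An infinite set of
vertices or edges would give a strictly descending chain of annihilators (`IsLeftArtinian.finite`,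
`IsRightArtinian.finite`). For a cycle `c`, a representation over `K⟦X⟧` has a diagonal coefficient
`l` on which multiplication by `c`, from either side, is multiplication by `1 - X`
(`exists_coefficient`). So `y ↦ y - y c` and `y ↦ y - c y` multiply `l` by `X`, and the images of
their iterates never stabilize (`iterate_ne`). -/

namespace LeavittPathAlgebra

/-! ### Generators, relations and the universal property. -/

section Generators

variable (K : Type w) [Field K] {V : Type u} {A : Type v} (E : DirectedGraph V A)

/-- The quotient map from the free algebra as a homomorphism. -/
noncomputable def mkHom : Free K V A →ₙ+* LeavittPathAlgebra K E where
  toFun := mk K E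
  map_mul' _ _ := rfl
  map_zero' := rfl
  map_add' _ _ := rfl

/-- A vertex as an element of the Leavitt path algebra. -/
noncomputable def vertex (v : V) : LeavittPathAlgebra K E := mkHom K E (gen K (.vertex v))

/-- An edge as an element of the Leavitt path algebra. -/
noncomputable def edge (f : A) : LeavittPathAlgebra K E := mkHom K E (gen K (.edge f))

/-- A ghost edge as an element of the Leavitt path algebra. -/
noncomputable def ghost (f : A) : LeavittPathAlgebra K E := mkHom K E (gen K (.ghost f))

variable {K E}

theorem mkHom_eq_of_rel {a b : Free K V A} (h : Rel K E a b) : mkHom K E a = mkHom K E b :=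
  (RingCon.eq _).2 (RingConGen.Rel.of _ _ ⟨1, a, b, h, by simp, by simp⟩)

variable (K E)

theorem vertex_mul_self (v : V) : vertex K E v * vertex K E v = vertex K E v := by
  simpa only [vertex, edge, ghost, map_mul]
    using mkHom_eq_of_rel (K := K) (E := E) (.idem v)

theorem vertex_mul_of_ne {v w : V} (h : v ≠ w) : vertex K E v * vertex K E w = 0 := by
  simpa only [vertex, edge, ghost, map_mul, map_zero]
    using mkHom_eq_of_rel (K := K) (E := E) (.orth v w h)

theorem source_mul_edge (f : A) : vertex K E (E.s f) * edge K E f = edge K E f := by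
  simpa only [vertex, edge, ghost, map_mul]
    using mkHom_eq_of_rel (K := K) (E := E) (.source_edge f)

theorem edge_mul_range (f : A) : edge K E f * vertex K E (E.r f) = edge K E f := by
  simpa only [vertex, edge, ghost, map_mul]
    using mkHom_eq_of_rel (K := K) (E := E) (.edge_range f)

theorem range_mul_ghost (f : A) : vertex K E (E.r f) * ghost K E f = ghost K E f := by
  simpa only [vertex, edge, ghost, map_mul]
    using mkHom_eq_of_rel (K := K) (E := E) (.range_ghost f)

theorem ghost_mul_source (f : A) : ghost K E f * vertex K E (E.s f) = ghost K E f := by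
  simpa only [vertex, edge, ghost, map_mul]
    using mkHom_eq_of_rel (K := K) (E := E) (.ghost_source f)

theorem ghost_mul_edge_self (f : A) : ghost K E f * edge K E f = vertex K E (E.r f) := by
  simpa only [vertex, edge, ghost, map_mul]
    using mkHom_eq_of_rel (K := K) (E := E) (.ghost_edge_self f)

theorem ghost_mul_edge_of_ne {f g : A} (h : f ≠ g) : ghost K E f * edge K E g = 0 := by
  simpa only [vertex, edge, ghost, map_mul, map_zero]
    using mkHom_eq_of_rel (K := K) (E := E) (.ghost_edge_ne f g h)

theorem vertex_eq_sum (v : V) (hfin : {f : A | E.s f = v}.Finite)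
    (hne : {f : A | E.s f = v}.Nonempty) :
    vertex K E v = ∑ f ∈ hfin.toFinset, edge K E f * ghost K E f := by
  simpa only [vertex, edge, ghost, map_mul, map_sum]
    using mkHom_eq_of_rel (K := K) (E := E) (.sum_edges v hfin hne)

theorem vertex_mul_edge_of_ne {v : V} {f : A} (h : v ≠ E.s f) :
    vertex K E v * edge K E f = 0 := by
  rw [← source_mul_edge, ← mul_assoc, vertex_mul_of_ne K E h, zero_mul]

theorem edge_mul_vertex_of_ne {v : V} {f : A} (h : E.r f ≠ v) :
    edge K E f * vertex K E v = 0 := by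
  rw [← edge_mul_range, mul_assoc, vertex_mul_of_ne K E h, mul_zero]

theorem vertex_mul_ghost_of_ne {v : V} {f : A} (h : v ≠ E.r f) :
    vertex K E v * ghost K E f = 0 := by
  rw [← range_mul_ghost, ← mul_assoc, vertex_mul_of_ne K E h, zero_mul]

theorem ghost_mul_vertex_of_ne {v : V} {f : A} (h : E.s f ≠ v) :
    ghost K E f * vertex K E v = 0 := by
  rw [← ghost_mul_source, mul_assoc, vertex_mul_of_ne K E h, mul_zero]

variable {K E}

theorem mkHom_smul (k : K) (a : Free K V A) : mkHom K E (k • a) = k • mkHom K E a := rfl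

/-- Induction on the elements of the Leavitt path algebra. -/
theorem induction_on {P : LeavittPathAlgebra K E → Prop} (x : LeavittPathAlgebra K E)
    (zero : P 0) (vertex : ∀ v, P (vertex K E v)) (edge : ∀ f, P (edge K E f))
    (ghost : ∀ f, P (ghost K E f)) (add : ∀ x y, P x → P y → P (x + y))
    (smul : ∀ (k : K) x, P x → P (k • x)) (mul : ∀ x y, P x → P y → P (x * y)) : P x := by
  obtain ⟨a, rfl⟩ : ∃ a, mkHom K E a = x := mk_surjective E x
  have hgen (g : Gen V A) : P (mkHom K E (gen K g)) := by
    cases g with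
    | vertex v => exact vertex v
    | edge f => exact edge f
    | ghost f => exact ghost f
  induction a using MonoidAlgebra.induction_linear with
  | zero => exact zero
  | add a b ha hb =>
    rw [map_add]
    exact add _ _ ha hb
  | single s k =>
    have hs : (MonoidAlgebra.single s k : Free K V A) = k • MonoidAlgebra.single s 1 := by
      rw [MonoidAlgebra.smul_single, smul_eq_mul, mul_one]
    rw [hs, mkHom_smul]
    refine smul _ _ ?_
    clear hs
    induction s using FreeSemigroup.recOnMul with
    | ih1 g => exact hgen g
    | ih2 g t hg ht =>
      rw [← mul_one (1 : K), ← MonoidAlgebra.single_mul_single, map_mul]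
      exact mul _ _ hg ht

section Lift

variable {B : Type*} [Ring B] [Algebra K B] (φ : Gen V A → B)

/-- The homomorphism from the free algebra given by the images of the generators. -/
noncomputable def liftFree : Free K V A →ₙₐ[K] B :=
  MonoidAlgebra.liftMagma K (FreeSemigroup.lift φ)

theorem liftFree_gen (g : Gen V A) : liftFree φ (gen K g) = φ g := by
  simp [liftFree, gen, MonoidAlgebra.liftMagma]

/-- The universal property of the Leavitt path algebra. -/
noncomputable def lift (h : ∀ a b, Rel K E a b → liftFree φ a = liftFree φ b) :
    LeavittPathAlgebra K E →ₙ+* B :=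
  have key (a b : Free K V A) (hab : con K E a b) : liftFree φ a = liftFree φ b := by
    change RingConGen.Rel _ a b at hab
    induction hab with
    | of x y hxy =>
      obtain ⟨k, x, y, hxy, rfl, rfl⟩ := hxy
      rw [map_smul, map_smul, h _ _ hxy]
    | refl => rfl
    | symm _ ih => exact ih.symm
    | trans _ _ ih ih' => exact ih.trans ih'
    | add _ _ ih ih' => rw [map_add, map_add, ih, ih']
    | mul _ _ ih ih' => rw [map_mul, map_mul, ih, ih']
  { toFun := Quotient.lift (liftFree φ) key
    map_mul' := by
      intro x y
      obtain ⟨a, rfl⟩ := mk_surjective E x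
      obtain ⟨b, rfl⟩ := mk_surjective E y
      exact map_mul (liftFree (K := K) φ) a b
    map_zero' := map_zero (liftFree (K := K) φ)
    map_add' := by
      intro x y
      obtain ⟨a, rfl⟩ := mk_surjective E x
      obtain ⟨b, rfl⟩ := mk_surjective E y
      exact map_add (liftFree (K := K) φ) a b }

theorem lift_mkHom_gen (h : ∀ a b, Rel K E a b → liftFree φ a = liftFree φ b) (g : Gen V A) :
    lift φ h (mkHom K E (gen K g)) = φ g :=
  liftFree_gen φ g

end Lift

end Generators

end LeavittPathAlgebra

/-! ### Branching systems with a prescribed fixed point. -/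

/-- Injections of `S` into itself, one for each edge, such that the images for distinct edges with
the same source are disjoint and, for the edges leaving a vertex, cover `S`. -/
structure BranchingSystem {V : Type u} {A : Type v} (E : DirectedGraph V A) (S : Type*) where
  map : A → S → S
  injective : ∀ f, Function.Injective (map f)
  eq_of_map_eq : ∀ f g x y, E.s f = E.s g → map f x = map g y → f = g
  exists_map_eq : ∀ f y, ∃ g x, E.s g = E.s f ∧ map g x = y

namespace BranchingSystem

open scoped Cardinal in
/-- There is a branching system with a common fixed point for any set of edges that have pairwise
distinct sources. -/
theorem exists_fixed {V : Type u} {A : Type v} (E : DirectedGraph V A) (P : Set A)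
    (hP : Set.InjOn E.s P) :
    ∃ (S : Type v) (b : BranchingSystem E S) (o : S), ∀ f ∈ P, b.map f o = o := by
  classical
  -- The summand `ℕ` makes `S` infinite and supplies `o`; the summand `A` gives `#A ≤ #S`. So
  -- `s⁻¹(v) × S` is equipotent with `S` whenever `v` emits an edge, and one bijection between them
  -- encodes injectivity, disjointness and covering at `v`.
  let S : Type v := A ⊕ ULift.{v} ℕ
  let o : S := Sum.inr ⟨0⟩
  have hS : ℵ₀ ≤ #S := Cardinal.aleph0_le_mk _
  have hA : #A ≤ #S := Cardinal.mk_le_of_injective Sum.inl_injective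
  have key (v : V) : ∃ g : {f : A // E.s f = v} × S → S, Function.Injective g ∧
      (Nonempty {f : A // E.s f = v} → Function.Surjective g) ∧
      ∀ f : {f : A // E.s f = v}, f.1 ∈ P → g (f, o) = o := by
    rcases isEmpty_or_nonempty {f : A // E.s f = v} with hv | hv
    · exact ⟨fun x => hv.elim x.1, fun x => hv.elim x.1, fun h => (not_isEmpty_iff.2 h hv).elim,
        fun f => hv.elim f⟩
    have hcard : #({f : A // E.s f = v} × S) = #S := by
      rw [Cardinal.mk_prod, Cardinal.lift_id, Cardinal.lift_id]
      exact Cardinal.mul_eq_right hS ((Cardinal.mk_subtype_le _).trans hA)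
        (Cardinal.mk_ne_zero _)
    obtain ⟨e⟩ := Cardinal.eq.1 hcard
    obtain ⟨f₀, hf₀⟩ : ∃ f₀ : {f : A // E.s f = v}, ∀ f : {f : A // E.s f = v},
        f.1 ∈ P → f = f₀ := by
      by_cases h : ∃ f : {f : A // E.s f = v}, f.1 ∈ P
      · obtain ⟨f₀, h₀⟩ := h
        exact ⟨f₀, fun f hf => Subtype.ext (hP hf h₀ (f.2.trans f₀.2.symm))⟩
      · exact ⟨Classical.choice hv, fun f hf => (h ⟨f, hf⟩).elim⟩
    -- A transposition moves the image of `(f₀, o)` to `o`. One correction per vertex suffices,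
    -- since at most one edge of `P` leaves it.
    refine ⟨e.trans (Equiv.swap (e (f₀, o)) o), Equiv.injective _, fun _ => Equiv.surjective _,
      fun f hf => ?_⟩
    rw [hf₀ f hf, Equiv.trans_apply, Equiv.swap_apply_left]
  choose g hinj hsurj hfix using key
  have aux (v : V) (f : A) (h : E.s f = v) (x : S) : g (E.s f) (⟨f, rfl⟩, x) = g v (⟨f, h⟩, x) := by
    subst h
    rfl
  refine ⟨S, ⟨fun f x => g (E.s f) (⟨f, rfl⟩, x), fun f x y h => ?_, fun f f' x y hs h => ?_,
    fun f y => ?_⟩, o, fun f hf => hfix _ ⟨f, rfl⟩ hf⟩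
  · exact (Prod.mk.inj (hinj _ h)).2
  · simp only [aux _ _ hs] at h
    exact congrArg Subtype.val (Prod.mk.inj (hinj _ h)).1
  · obtain ⟨⟨⟨f', hf'⟩, x⟩, hx⟩ := hsurj (E.s f) ⟨⟨f, rfl⟩⟩ y
    exact ⟨f', x, hf', (aux _ _ hf' x).trans hx⟩

theorem edge_cases {V : Type u} {A : Type v} {E : DirectedGraph V A} {S : Type*}
    (b : BranchingSystem E S) (f : A) (v : V) (y : S) :
    (v = E.s f ∧ ∃ x, b.map f x = y) ∨ (v = E.s f → ∀ x, b.map f x ≠ y) := by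
  by_cases h : v = E.s f ∧ ∃ x, b.map f x = y
  · exact .inl h
  · exact .inr fun h₁ x h₂ => h ⟨h₁, x, h₂⟩

/-! ### Weighted representations on functions on `V × S`. -/

section Representation

variable {V : Type u} {A : Type v} {E : DirectedGraph V A} {S : Type*} [Nonempty S]
  (b : BranchingSystem E S) (K : Type w) [Field K] {R : Type*} [CommRing R] [Algebra K R]
  (c : A → Rˣ)

open scoped Classical in
/-- The action of the generators of the Leavitt path algebra on the functions on `V × S`: an edge
`f` carries its range to its source along `b.map f` and multiplies by the weight `c f`. -/
noncomputable def genAction : LeavittPathAlgebra.Gen V A → Module.End R (V × S → R)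
  | .vertex v =>
    { toFun := fun φ x => if x.1 = v then φ x else 0
      map_add' := fun φ ψ => by ext x; by_cases h : x.1 = v <;> simp [h]
      map_smul' := fun k φ => by ext x; by_cases h : x.1 = v <;> simp [h] }
  | .edge f =>
    { toFun := fun φ x => if x.1 = E.s f ∧ x.2 ∈ Set.range (b.map f) then
        c f * φ (E.r f, Function.invFun (b.map f) x.2) else 0
      map_add' := fun φ ψ => by
        funext x
        simp only [Pi.add_apply]
        split_ifs
        · rw [mul_add]
        · rw [add_zero]
      map_smul' := fun k φ => by
        funext x
        simp only [Pi.smul_apply, smul_eq_mul, RingHom.id_apply]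
        split_ifs
        · rw [mul_left_comm]
        · rw [mul_zero] }
  | .ghost f =>
    { toFun := fun φ x => if x.1 = E.r f then (c f)⁻¹ * φ (E.s f, b.map f x.2) else 0
      map_add' := fun φ ψ => by ext x; by_cases h : x.1 = E.r f <;> simp [h, mul_add]
      map_smul' := fun k φ => by ext x; by_cases h : x.1 = E.r f <;> simp [h, mul_left_comm] }

variable (φ : V × S → R)

theorem genAction_vertex_self (v : V) (x : S) :
    b.genAction c (.vertex v) φ (v, x) = φ (v, x) :=
  if_pos rfl

theorem genAction_vertex_of_ne {v w : V} (h : w ≠ v) (x : S) :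
    b.genAction c (.vertex v) φ (w, x) = 0 :=
  if_neg h

theorem genAction_edge_map (f : A) (x : S) :
    b.genAction c (.edge f) φ (E.s f, b.map f x) = c f * φ (E.r f, x) := by
  refine (if_pos ⟨rfl, x, rfl⟩).trans ?_
  rw [Function.leftInverse_invFun (b.injective f) x]

theorem genAction_edge_eq_zero {f : A} {v : V} {y : S} (h : v = E.s f → ∀ x, b.map f x ≠ y) :
    b.genAction c (.edge f) φ (v, y) = 0 :=
  if_neg fun ⟨h₁, x, h₂⟩ => h h₁ x h₂

theorem genAction_ghost_self (f : A) (x : S) :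
    b.genAction c (.ghost f) φ (E.r f, x) = (c f)⁻¹ * φ (E.s f, b.map f x) :=
  if_pos rfl

theorem genAction_ghost_of_ne {f : A} {v : V} (h : v ≠ E.r f) (x : S) :
    b.genAction c (.ghost f) φ (v, x) = 0 :=
  if_neg h

/-- The relations for `f* g` express injectivity of the branching maps and disjointness of their
images. The sum relation is the covering property: exactly one edge leaving the vertex has a given
point in its image, so one summand survives. -/
theorem liftFree_genAction_eq (a a' : LeavittPathAlgebra.Free K V A)
    (h : LeavittPathAlgebra.Rel K E a a') :
    LeavittPathAlgebra.liftFree (b.genAction c) a =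
      LeavittPathAlgebra.liftFree (b.genAction c) a' := by
  classical
  refine LinearMap.ext fun φ => funext fun ⟨v, y⟩ => ?_
  cases h with
  | idem u =>
    simp only [map_mul, LeavittPathAlgebra.liftFree_gen, Module.End.mul_apply]
    by_cases h : v = u
    · subst h
      rw [genAction_vertex_self]
    · rw [genAction_vertex_of_ne _ _ _ h, genAction_vertex_of_ne _ _ _ h]
  | orth u u' hne =>
    simp only [map_mul, map_zero, LeavittPathAlgebra.liftFree_gen, Module.End.mul_apply]
    by_cases h : v = u
    · subst h
      rw [genAction_vertex_self, genAction_vertex_of_ne _ _ _ hne]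
      rfl
    · rw [genAction_vertex_of_ne _ _ _ h]
      rfl
  | source_edge f =>
    simp only [map_mul, LeavittPathAlgebra.liftFree_gen, Module.End.mul_apply]
    by_cases h : v = E.s f
    · subst h
      rw [genAction_vertex_self]
    · rw [genAction_vertex_of_ne _ _ _ h, genAction_edge_eq_zero _ _ _ fun h' => (h h').elim]
  | edge_range f =>
    simp only [map_mul, LeavittPathAlgebra.liftFree_gen, Module.End.mul_apply]
    rcases b.edge_cases f v y with ⟨rfl, x, rfl⟩ | h
    · rw [genAction_edge_map, genAction_edge_map, genAction_vertex_self]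
    · rw [genAction_edge_eq_zero _ _ _ h, genAction_edge_eq_zero _ _ _ h]
  | range_ghost f =>
    simp only [map_mul, LeavittPathAlgebra.liftFree_gen, Module.End.mul_apply]
    by_cases h : v = E.r f
    · subst h
      rw [genAction_vertex_self]
    · rw [genAction_vertex_of_ne _ _ _ h, genAction_ghost_of_ne _ _ _ h]
  | ghost_source f =>
    simp only [map_mul, LeavittPathAlgebra.liftFree_gen, Module.End.mul_apply]
    by_cases h : v = E.r f
    · subst h
      rw [genAction_ghost_self, genAction_ghost_self, genAction_vertex_self]
    · rw [genAction_ghost_of_ne _ _ _ h, genAction_ghost_of_ne _ _ _ h]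
  | ghost_edge_self f =>
    simp only [map_mul, LeavittPathAlgebra.liftFree_gen, Module.End.mul_apply]
    by_cases h : v = E.r f
    · subst h
      rw [genAction_ghost_self, genAction_edge_map, genAction_vertex_self, Units.inv_mul_cancel_left]
    · rw [genAction_ghost_of_ne _ _ _ h, genAction_vertex_of_ne _ _ _ h]
  | ghost_edge_ne f g hne =>
    simp only [map_mul, map_zero, LeavittPathAlgebra.liftFree_gen, Module.End.mul_apply]
    by_cases h : v = E.r f
    · subst h
      rw [genAction_ghost_self, genAction_edge_eq_zero _ _ _
        fun hs x hx => hne (b.eq_of_map_eq _ _ _ _ hs hx.symm), mul_zero]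
      rfl
    · rw [genAction_ghost_of_ne _ _ _ h]
      rfl
  | sum_edges u hfin hne =>
    simp only [map_mul, map_sum, LeavittPathAlgebra.liftFree_gen, Module.End.mul_apply,
      LinearMap.sum_apply, Finset.sum_apply]
    by_cases h : v = u
    · subst h
      obtain ⟨f₀, rfl⟩ := hne
      obtain ⟨g, x, hg, rfl⟩ := b.exists_map_eq f₀ y
      rw [genAction_vertex_self, Finset.sum_eq_single_of_mem g (by simpa using hg)]
      · rw [← hg, genAction_edge_map, genAction_ghost_self, Units.mul_inv_cancel_left]
      · intro f _ hfg
        exact genAction_edge_eq_zero _ _ _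
          fun hs x' hx' => hfg (b.eq_of_map_eq _ _ _ _ (hs.symm.trans hg.symm) hx')
    · rw [genAction_vertex_of_ne _ _ _ h, Finset.sum_eq_zero]
      intro f hf
      refine genAction_edge_eq_zero _ _ _ fun h' => (h ?_).elim
      exact h'.trans (by simpa using hf)

/-- The representation of the Leavitt path algebra given by a branching system and weights. -/
noncomputable def rep : LeavittPathAlgebra K E →ₙ+* Module.End R (V × S → R) :=
  LeavittPathAlgebra.lift (b.genAction c) (b.liftFree_genAction_eq K c)

theorem rep_vertex (v : V) :
    b.rep K c (LeavittPathAlgebra.vertex K E v) = b.genAction c (.vertex v) :=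
  LeavittPathAlgebra.lift_mkHom_gen _ _ _

theorem rep_edge (f : A) :
    b.rep K c (LeavittPathAlgebra.edge K E f) = b.genAction c (.edge f) :=
  LeavittPathAlgebra.lift_mkHom_gen _ _ _

open scoped Classical in
theorem genAction_edge_single (f : A) (x : S) (a : R) :
    b.genAction c (.edge f) (Pi.single (E.r f, x) a) =
      Pi.single (E.s f, b.map f x) (c f * a) := by
  funext ⟨v, y⟩
  rcases b.edge_cases f v y with ⟨rfl, z, rfl⟩ | h
  · rw [genAction_edge_map]
    by_cases hz : z = x
    · subst hz
      simp
    · rw [Pi.single_eq_of_ne (by simpa using hz), Pi.single_eq_of_ne, mul_zero]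
      simpa using fun h => hz (b.injective f h)
  · rw [genAction_edge_eq_zero _ _ _ h, Pi.single_eq_of_ne]
    simp only [ne_eq, Prod.mk.injEq, not_and]
    exact fun h₁ h₂ => h h₁ x h₂.symm

end Representation

end BranchingSystem

namespace LeavittPathAlgebra

/-- In any of the representations a vertex acts as the projection to functions on its own fibre,
which is nonzero. No fixed edges and no weights are needed here. -/
theorem vertex_ne_zero (K : Type w) [Field K] {V : Type u} {A : Type v} (E : DirectedGraph V A)
    (v : V) : vertex K E v ≠ 0 := by
  obtain ⟨S, b, o, -⟩ := BranchingSystem.exists_fixed E ∅ (by simp)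
  have : Nonempty S := ⟨o⟩
  intro h
  have h₁ := b.rep_vertex K (R := K) (fun _ => 1) v
  rw [h, map_zero] at h₁
  have h₂ := b.genAction_vertex_self (fun _ => 1) (fun _ => (1 : K)) v o
  rw [← h₁] at h₂
  exact zero_ne_one h₂

end LeavittPathAlgebra

/-! ### Consequences of the chain conditions. -/

namespace NonUnitalRing

variable {R : Type u} [NonUnitalRing R]

/-- The left annihilators of the first `n` of the `b i` form a chain; it drops at every step because
the next `a` kills all earlier `b` but not its own partner. -/
theorem IsLeftArtinian.finite {ι : Type*} (hR : IsLeftArtinian R) {a b : ι → R}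
    (h₀ : ∀ i j, i ≠ j → a i * b j = 0) (h₁ : ∀ i, a i * b i ≠ 0) : Finite ι := by
  by_contra hι
  have : Infinite ι := not_finite_iff_infinite.1 hι
  let e := Infinite.natEmbedding ι
  let I : ℕ → AddSubgroup R := fun n =>
    { carrier := {x | ∀ i < n, x * b (e i) = 0}
      add_mem' := fun hx hy i hi => by rw [add_mul, hx i hi, hy i hi, add_zero]
      zero_mem' := fun i _ => zero_mul _
      neg_mem' := fun hx i hi => by rw [neg_mul, hx i hi, neg_zero] }
  obtain ⟨n, hn⟩ := hR I (fun n a x hx i hi => by rw [mul_assoc, hx i hi, mul_zero])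
    (fun m n hmn x hx i hi => hx i (hi.trans_le hmn))
  have hmem : a (e n) ∈ I n := fun i hi => h₀ _ _ (e.injective.ne hi.ne')
  rw [← hn (n + 1) n.le_succ] at hmem
  exact h₁ _ (hmem n n.lt_succ_self)

theorem IsRightArtinian.finite {ι : Type*} (hR : IsRightArtinian R) {a b : ι → R}
    (h₀ : ∀ i j, i ≠ j → a i * b j = 0) (h₁ : ∀ i, a i * b i ≠ 0) : Finite ι := by
  by_contra hι
  have : Infinite ι := not_finite_iff_infinite.1 hι
  let e := Infinite.natEmbedding ι
  let I : ℕ → AddSubgroup R := fun n =>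
    { carrier := {x | ∀ i < n, a (e i) * x = 0}
      add_mem' := fun hx hy i hi => by rw [mul_add, hx i hi, hy i hi, add_zero]
      zero_mem' := fun i _ => mul_zero _
      neg_mem' := fun hx i hi => by rw [mul_neg, hx i hi, neg_zero] }
  obtain ⟨n, hn⟩ := hR I (fun n a x hx i hi => by rw [← mul_assoc, hx i hi, zero_mul])
    (fun m n hmn x hx i hi => hx i (hi.trans_le hmn))
  have hmem : b (e n) ∈ I n := fun i hi => h₀ _ _ (e.injective.ne hi.ne)
  rw [← hn (n + 1) n.le_succ] at hmem
  exact h₁ _ (hmem n n.lt_succ_self)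

/-- The range of an iterate of an additive map. -/
def iterateRange (T : R →+ R) (n : ℕ) : AddSubgroup R where
  carrier := Set.range T^[n]
  add_mem' := by
    rintro _ _ ⟨x, rfl⟩ ⟨y, rfl⟩
    exact ⟨x + y, iterate_map_add T n x y⟩
  zero_mem' := ⟨0, iterate_map_zero T n⟩
  neg_mem' := by
    rintro _ ⟨x, rfl⟩
    exact ⟨-x, iterate_map_neg T n x⟩

theorem iterateRange_antitone (T : R →+ R) : Antitone (iterateRange T) := by
  refine antitone_nat_of_succ_le fun n => ?_
  rintro _ ⟨x, rfl⟩
  exact ⟨T x, rfl⟩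

/-- Since `T` is left linear, the images of its iterates are left ideals, and their chain must
stabilize. -/
theorem IsLeftArtinian.exists_iterate_eq (hR : IsLeftArtinian R) (T : R →+ R)
    (hT : ∀ a x, T (a * x) = a * T x) (y : R) : ∃ n x, T^[n + 1] x = T^[n] y := by
  obtain ⟨n, hn⟩ := hR (iterateRange T) (fun n a x hx => by
    obtain ⟨x, rfl⟩ := hx
    exact ⟨a * x, Function.Commute.iterate_left (f := T) (g := (a * ·)) (hT a) n x⟩)
    (iterateRange_antitone T)
  have h : T^[n] y ∈ iterateRange T n := ⟨y, rfl⟩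
  rw [← hn (n + 1) n.le_succ] at h
  exact ⟨n, h⟩

theorem IsRightArtinian.exists_iterate_eq (hR : IsRightArtinian R) (T : R →+ R)
    (hT : ∀ a x, T (x * a) = T x * a) (y : R) : ∃ n x, T^[n + 1] x = T^[n] y := by
  obtain ⟨n, hn⟩ := hR (iterateRange T) (fun n a x hx => by
    obtain ⟨x, rfl⟩ := hx
    exact ⟨x * a, Function.Commute.iterate_left (f := T) (g := (· * a)) (hT a) n x⟩)
    (iterateRange_antitone T)
  have h : T^[n] y ∈ iterateRange T n := ⟨y, rfl⟩
  rw [← hn (n + 1) n.le_succ] at h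
  exact ⟨n, h⟩

end NonUnitalRing

/-! ### Cycles contradict the chain conditions. -/

namespace BranchingSystem

variable {V : Type u} {A : Type v} {E : DirectedGraph V A} {S : Type*} [Nonempty S]
  (b : BranchingSystem E S) (K : Type w) [Field K] {R : Type*} [CommRing R] [Algebra K R]
  (c : A → Rˣ)

open scoped Classical in
/-- The element `x` carries the coordinate `j` to the coordinate `i`, and no other coordinate to
`i`, with the factor `a`. -/
structure Carries (x : LeavittPathAlgebra K E) (i j : V × S) (a : R) : Prop where
  apply : ∀ φ, b.rep K c x φ i = a * φ j
  single : b.rep K c x (Pi.single j 1) = Pi.single i a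

variable {b K c}

/-- Both halves of `Carries` are needed: `apply` evaluates products with the element on the left,
`single` those with it on the right. -/
theorem carries_edge {f : A} {o : S} (h : b.map f o = o) :
    b.Carries K c (LeavittPathAlgebra.edge K E f) (E.s f, o) (E.r f, o) (c f) where
  apply φ := by
    rw [rep_edge]
    simpa only [h] using b.genAction_edge_map c φ f o
  single := by
    classical
    rw [rep_edge]
    simpa only [h, mul_one] using b.genAction_edge_single c f o 1

theorem Carries.mul_edge {x : LeavittPathAlgebra K E} {i : V × S} {a : R} {f : A} {o : S}
    (hx : b.Carries K c x i (E.s f, o) a) (h : b.map f o = o) (hf : c f = 1) :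
    b.Carries K c (x * LeavittPathAlgebra.edge K E f) i (E.r f, o) a where
  apply φ := by
    rw [map_mul, Module.End.mul_apply, hx.apply, (carries_edge h).apply, hf, Units.val_one, one_mul]
  single := by
    rw [map_mul, Module.End.mul_apply, (carries_edge h).single, hf, Units.val_one, hx.single]

/-- The first edge is kept apart as the start of the fold: there is no identity to start from, and
it alone may have a weight other than `1`. -/
theorem Carries.foldl {i : V × S} {a : R} {o : S} (p : List A) :
    ∀ (e : A) (x : LeavittPathAlgebra K E), (e :: p).IsChain (fun e f => E.r e = E.s f) →
      (∀ f ∈ p, b.map f o = o) → (∀ f ∈ p, c f = 1) → b.Carries K c x i (E.r e, o) a →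
      b.Carries K c (p.foldl (fun x f => x * LeavittPathAlgebra.edge K E f) x) i
        (E.r ((e :: p).getLast (List.cons_ne_nil e p)), o) a := by
  induction p with
  | nil => exact fun e x _ _ _ hx => hx
  | cons f p ih =>
    intro e x hc ho h₁ hx
    rw [List.isChain_cons_cons] at hc
    rw [hc.1] at hx
    rw [List.getLast_cons (List.cons_ne_nil f p)]
    exact ih f _ hc.2 (fun g hg => ho g (List.mem_cons_of_mem f hg))
      (fun g hg => h₁ g (List.mem_cons_of_mem f hg))
      (hx.mul_edge (ho f List.mem_cons_self) (h₁ f List.mem_cons_self))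

end BranchingSystem

namespace LeavittPathAlgebra

open PowerSeries

variable (K : Type w) [Field K] {V : Type u} {A : Type v} {E : DirectedGraph V A}

/-- A cycle `c` gives a matrix coefficient on which `c` acts from both sides as `1 - X`. -/
theorem exists_coefficient (hE : ¬ E.IsAcyclic) :
    ∃ (c v : LeavittPathAlgebra K E) (l : LeavittPathAlgebra K E →+ K⟦X⟧), l v = 1 ∧
      (∀ y, l (c * y) = (1 - X) * l y) ∧ ∀ y, l (y * c) = (1 - X) * l y := by
  classical
  unfold DirectedGraph.IsAcyclic at hE
  push Not at hE
  obtain ⟨p, ⟨hne, hc⟩, ⟨h, hs⟩, hnodup⟩ := hE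
  obtain ⟨S, b, o, ho⟩ := BranchingSystem.exists_fixed E {f | f ∈ p}
    (fun f hf g hg => List.inj_on_of_nodup_map hnodup hf hg)
  have : Nonempty S := ⟨o⟩
  obtain ⟨e, p, rfl⟩ := List.exists_cons_of_ne_nil hne
  -- Weights must be units because ghost edges act by their inverses. Over `K⟦X⟧` the series `1 - X`
  -- is one, with the geometric series as inverse, while `1 - (1 - X) = X` is not.
  let t : K⟦X⟧ˣ := ⟨1 - X, PowerSeries.mk 1, by rw [mul_comm, mk_one_mul_one_sub_eq_one],
    mk_one_mul_one_sub_eq_one K⟩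
  let c : A → K⟦X⟧ˣ := Function.update 1 e t
  -- Distinct sources force distinct edges, so the weight is met exactly once around the cycle.
  have he : e ∉ p := (List.nodup_cons.1 (List.Nodup.of_map _ hnodup)).1
  have hcar := BranchingSystem.Carries.foldl (b := b) (c := c) p e (edge K E e) hc
    (fun f hf => ho f (List.mem_cons_of_mem e hf))
    (fun f hf => Function.update_of_ne (ne_of_mem_of_not_mem hf he) _ _)
    (BranchingSystem.carries_edge (ho e List.mem_cons_self))
  -- The cycle closes up, so it carries a coordinate to itself; `l` below is the diagonal
  -- coefficient there.
  rw [← hs] at hcar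
  have hce : ((c e : K⟦X⟧ˣ) : K⟦X⟧) = 1 - X := by
    simp only [c, Function.update_self]
    rfl
  rw [hce] at hcar
  simp only [List.head_cons] at hcar
  generalize p.foldl (fun x f => x * edge K E f) (edge K E e) = x at hcar
  let l : LeavittPathAlgebra K E →+ K⟦X⟧ :=
    { toFun := fun y => b.rep K c y (Pi.single (E.s e, o) 1) (E.s e, o)
      map_zero' := by rw [map_zero]; rfl
      map_add' := fun x y => by rw [map_add]; rfl }
  refine ⟨x, vertex K E (E.s e), l, ?_, fun y => ?_, fun y => ?_⟩
  rotate_left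
  · change b.rep K c (x * y) _ _ = _
    rw [map_mul, Module.End.mul_apply, hcar.apply]
    rfl
  · change b.rep K c (y * x) _ _ = _
    have hsmul : (Pi.single (E.s e, o) (1 - X) : V × S → K⟦X⟧) =
        (1 - X : K⟦X⟧) • Pi.single (E.s e, o) 1 := by
      rw [← Pi.single_smul, smul_eq_mul, mul_one]
    rw [map_mul, Module.End.mul_apply, hcar.single, hsmul, map_smul]
    rfl
  · change b.rep K c _ _ _ = _
    rw [BranchingSystem.rep_vertex, BranchingSystem.genAction_vertex_self, Pi.single_eq_same]

/-- Equality would give `X ^ (n + 1) * l x = X ^ n`, hence `X * l x = 1`, which fails at the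
constant coefficient. -/
theorem iterate_ne {R : Type*} [AddGroup R] (l : R →+ K⟦X⟧) (T : R → R)
    (hT : ∀ y, l (T y) = X * l y) {v : R} (hv : l v = 1) (n : ℕ) (x : R) :
    T^[n + 1] x ≠ T^[n] v := by
  have hiter (n : ℕ) (y : R) : l (T^[n] y) = X ^ n * l y := by
    induction n with
    | zero => simp
    | succ n ih => rw [Function.iterate_succ_apply', hT, ih, pow_succ', mul_assoc]
  intro h
  have h' := congrArg l h
  rw [hiter, hiter, hv, pow_succ, mul_assoc] at h'
  have h'' := congrArg constantCoeff (mul_left_cancel₀ (pow_ne_zero n X_ne_zero) h')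
  simp at h''

variable {K}

theorem isAcyclic_of_isLeftArtinian
    (hR : NonUnitalRing.IsLeftArtinian (LeavittPathAlgebra K E)) : E.IsAcyclic := by
  by_contra hE
  obtain ⟨c, v, l, hv, -, hl⟩ := exists_coefficient K hE
  -- This map stands in for right multiplication by `1 - c`, as the algebra may lack an identity.
  obtain ⟨n, x, h⟩ := hR.exists_iterate_eq (AddMonoidHom.id _ - AddMonoidHom.mulRight c)
    (fun a x => by simp [mul_sub, mul_assoc]) v
  exact iterate_ne K l _ (fun y => by simp [hl]; ring) hv n x h

theorem isAcyclic_of_isRightArtinian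
    (hR : NonUnitalRing.IsRightArtinian (LeavittPathAlgebra K E)) : E.IsAcyclic := by
  by_contra hE
  obtain ⟨c, v, l, hv, hl, -⟩ := exists_coefficient K hE
  obtain ⟨n, x, h⟩ := hR.exists_iterate_eq (AddMonoidHom.id _ - AddMonoidHom.mulLeft c)
    (fun a x => by simp [sub_mul, mul_assoc]) v
  exact iterate_ne K l _ (fun y => by simp [hl]; ring) hv n x h

end LeavittPathAlgebra

/-! ### Semisimple rings and the socle. -/

namespace NonUnitalRing

variable {R : Type u}

theorem isLeftArtinian_of_isArtinianRing [Ring R] [IsArtinianRing R] : IsLeftArtinian R := by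
  intro I hI hanti
  let J : ℕ → Submodule R R := fun n => { I n with smul_mem' := fun a _ hx => hI n a _ hx }
  obtain ⟨n, hn⟩ := _root_.IsArtinian.monotone_stabilizes (R := R) (M := R)
    ⟨fun n => OrderDual.toDual (J n), fun _ _ h => OrderDual.toDual_le_toDual.2
      fun _ hx => hanti h hx⟩
  refine ⟨n, fun m hm => SetLike.ext fun x => ?_⟩
  exact (SetLike.ext_iff.1 (OrderDual.toDual.injective (hn m hm)) x).symm

theorem isRightArtinian_of_isArtinianRing_op [Ring R] [IsArtinianRing Rᵐᵒᵖ] :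
    IsRightArtinian R := by
  intro I hI hanti
  let J : ℕ → Submodule Rᵐᵒᵖ Rᵐᵒᵖ := fun n =>
    { carrier := MulOpposite.unop ⁻¹' (I n : Set R)
      add_mem' := (I n).add_mem
      zero_mem' := (I n).zero_mem
      smul_mem' := fun a _ hx => hI n a.unop _ hx }
  obtain ⟨n, hn⟩ := _root_.IsArtinian.monotone_stabilizes (R := Rᵐᵒᵖ) (M := Rᵐᵒᵖ)
    ⟨fun n => OrderDual.toDual (J n), fun _ _ h => OrderDual.toDual_le_toDual.2
      fun _ hx => hanti h hx⟩
  refine ⟨n, fun m hm => SetLike.ext fun x => ?_⟩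
  exact (SetLike.ext_iff.1 (OrderDual.toDual.injective (hn m hm)) (MulOpposite.op x)).symm

/-- A unital semisimple ring is artinian. -/
theorem IsUnitalSemisimple.isArtinian [NonUnitalRing R] (h : IsUnitalSemisimple R) :
    IsArtinian R := by
  obtain ⟨e, he, -, hss⟩ := h
  let := he.ring
  -- Instance search supplies that the opposite of a semisimple ring is artinian as well.
  exact ⟨isLeftArtinian_of_isArtinianRing, isRightArtinian_of_isArtinianRing_op⟩

/-- An element that is zero or generates a minimal left ideal `R a` that contains it. -/
def IsLeftMinimal [NonUnitalRing R] (a : R) : Prop := ∀ y : R, y * a = 0 ∨ ∃ z, z * (y * a) = a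

/-- Right multiplication by `b` is left linear, so it maps `R a` onto a simple or zero left ideal.
-/
theorem IsLeftMinimal.mul_right [NonUnitalRing R] {a : R} (h : IsLeftMinimal a) (b : R) :
    IsLeftMinimal (a * b) := by
  intro y
  rcases h y with h | ⟨z, h⟩
  · exact .inl (by rw [← mul_assoc, h, zero_mul])
  · exact .inr ⟨z, by rw [← mul_assoc y, ← mul_assoc, h]⟩

theorem IsLeftMinimal.mul_left [NonUnitalRing R] {a : R} (h : IsLeftMinimal a) (b : R) :
    IsLeftMinimal (b * a) := by
  intro y
  rcases h (y * b) with h | ⟨z, h⟩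
  · exact .inl (by rw [← mul_assoc, h])
  · exact .inr ⟨b * z, by rw [← mul_assoc y, mul_assoc, h]⟩

/-- The sum of the minimal left ideals. -/
def socle (R : Type u) [NonUnitalRing R] : AddSubgroup R :=
  AddSubgroup.closure {a | IsLeftMinimal a}

theorem mul_mem_socle [NonUnitalRing R] {x : R} (a b : R) (hx : x ∈ socle R) :
    a * x * b ∈ socle R := by
  induction hx using AddSubgroup.closure_induction with
  | mem x hx => exact AddSubgroup.subset_closure ((hx.mul_left a).mul_right b)
  | zero => simp [zero_mem]
  | add x y _ _ hx hy =>
    rw [mul_add, add_mul]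
    exact add_mem hx hy
  | neg x _ hx =>
    rw [mul_neg, neg_mul]
    exact neg_mem hx

/-- The left ideals `R a` with `a` minimal are simple or zero, and their sum contains `1`. -/
theorem isSemisimpleRing_of_one_mem_socle [Ring R] (h : (1 : R) ∈ socle R) :
    IsSemisimpleRing R := by
  refine isSemisimpleModule_of_isSemisimpleModule_submodule'
    (p := fun a : {a : R // IsLeftMinimal a} => Submodule.span R {a.1}) (fun a => ?_) ?_
  · by_cases ha : a.1 = 0
    · rw [ha, Submodule.span_zero_singleton]
      exact { exists_isCompl := fun N => ⟨N, disjoint_iff.2 (Subsingleton.elim _ _),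
        codisjoint_iff.2 (Subsingleton.elim _ _)⟩ }
    · have : IsSimpleModule R (Submodule.span R {a.1}) := by
        refine isSimpleModule_iff_toSpanSingleton_surjective.2 ⟨?_, ?_⟩
        · exact ⟨⟨a.1, Submodule.mem_span_singleton_self _⟩, 0, by simpa using ha⟩
        · rintro ⟨x, hx⟩ hx0 ⟨y, hy⟩
          obtain ⟨k, rfl⟩ := Submodule.mem_span_singleton.1 hx
          obtain ⟨l, rfl⟩ := Submodule.mem_span_singleton.1 hy
          rcases a.2 k with h | ⟨z, hz⟩
          · exact (hx0 (Subtype.ext h)).elim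
          · refine ⟨l * z, Subtype.ext ?_⟩
            simp only [smul_eq_mul, LinearMap.toSpanSingleton_apply, Submodule.coe_smul]
            rw [mul_assoc, hz]
      infer_instance
  · rw [Ideal.eq_top_iff_one]
    have hle : socle R ≤
        (⨆ a : {a : R // IsLeftMinimal a}, Submodule.span R {a.1}).toAddSubgroup :=
      (AddSubgroup.closure_le _).2 fun a ha =>
        Submodule.mem_iSup_of_mem (⟨a, ha⟩ : {a : R // IsLeftMinimal a})
          (Submodule.mem_span_singleton_self a)
    exact hle h

end NonUnitalRing

/-! ### Acyclic graphs and well-founded descent along edges. -/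

namespace DirectedGraph

variable {V : Type u} {A : Type v} {E : DirectedGraph V A}

/-- Cycles are required to have distinct sources. If edges `i < j` of a closed path share a source,
edges `i, …, j - 1` form a shorter closed path, so induction on the length applies. -/
theorem IsAcyclic.head_ne_getLast (hE : E.IsAcyclic) (n : ℕ) : ∀ p : List A, p.length ≤ n →
    p.IsChain (fun e f => E.r e = E.s f) → ∀ h : p ≠ [], E.s (p.head h) ≠ E.r (p.getLast h) := by
  induction n with
  | zero => exact fun p hp _ h => (h (List.length_eq_zero_iff.1 (Nat.le_zero.1 hp))).elim
  | succ n ih =>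
    intro p hp hc h heq
    refine hE p ⟨⟨h, hc⟩, ⟨h, heq⟩, ?_⟩
    by_contra hdup
    rw [List.Nodup, List.pairwise_map, List.pairwise_iff_getElem] at hdup
    push Not at hdup
    obtain ⟨i, j, hi, hj, hij, hs⟩ := hdup
    have hlen : ((p.drop i).take (j - i)).length = j - i := by
      rw [List.length_take, List.length_drop]
      omega
    have hne : (p.drop i).take (j - i) ≠ [] := by
      rw [← List.length_pos_iff, hlen]
      omega
    refine ih _ (by omega) ((hc.drop i).take (j - i)) hne ?_
    have hlink := List.isChain_iff_getElem.1 hc (j - 1) (by omega)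
    rw [List.head_eq_getElem, List.getLast_eq_getElem]
    simp only [List.getElem_take, List.getElem_drop, hlen, add_zero]
    rw [hs]
    have h₁ : i + (j - i - 1) = j - 1 := by omega
    have h₂ : j - 1 + 1 = j := by omega
    simp only [h₁]
    simp only [h₂] at hlink
    exact hlink.symm

/-- The relation puts the range of an edge below its source, so each further step prepends an edge.
-/
theorem exists_chain_of_transGen {u v : V}
    (h : Relation.TransGen (fun u v => ∃ f, E.s f = v ∧ E.r f = u) u v) :
    ∃ (p : List A) (hp : p ≠ []), p.IsChain (fun e f => E.r e = E.s f) ∧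
      E.s (p.head hp) = v ∧ E.r (p.getLast hp) = u := by
  induction h with
  | single h =>
    obtain ⟨f, rfl, rfl⟩ := h
    exact ⟨[f], by simp, by simp, by simp, by simp⟩
  | tail _ h ih =>
    obtain ⟨f, rfl, hf⟩ := h
    obtain ⟨p, hp, hc, hs, hr⟩ := ih
    obtain ⟨g, p, rfl⟩ := List.exists_cons_of_ne_nil hp
    refine ⟨f :: g :: p, by simp, List.isChain_cons_cons.2 ⟨hf.trans hs.symm, hc⟩, rfl, ?_⟩
    rwa [List.getLast_cons hp]

theorem IsAcyclic.wellFounded [Finite V] (hE : E.IsAcyclic) :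
    WellFounded (fun u v => ∃ f, E.s f = v ∧ E.r f = u) := by
  have : Std.Irrefl (Relation.TransGen (fun u v => ∃ f, E.s f = v ∧ E.r f = u)) := by
    refine ⟨fun v hv => ?_⟩
    obtain ⟨p, hp, hc, hs, hr⟩ := exists_chain_of_transGen hv
    exact hE.head_ne_getLast _ p le_rfl hc hp (hs.trans hr.symm)
  exact Subrelation.wf (fun h => Relation.TransGen.single h)
    (Finite.wellFounded_of_trans_of_irrefl
      (Relation.TransGen fun u v => ∃ f, E.s f = v ∧ E.r f = u))

end DirectedGraph

/-! ### Sinks generate minimal left ideals. -/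

namespace LeavittPathAlgebra

open NonUnitalRing

variable (K : Type w) [Field K] {V : Type u} {A : Type v} (E : DirectedGraph V A)

theorem isIdentity_sum_vertex [Fintype V] :
    IsIdentity (∑ v, vertex K E v : LeavittPathAlgebra K E) := by
  classical
  have h (a : LeavittPathAlgebra K E) :
      (∑ v, vertex K E v) * a = a ∧ a * (∑ v, vertex K E v) = a := by
    induction a using induction_on with
    | zero => simp
    | vertex u =>
      rw [Finset.sum_mul, Finset.mul_sum, Finset.sum_eq_single_of_mem u (Finset.mem_univ _),
        Finset.sum_eq_single_of_mem u (Finset.mem_univ _)]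
      · exact ⟨vertex_mul_self K E u, vertex_mul_self K E u⟩
      · exact fun v _ h => vertex_mul_of_ne K E h.symm
      · exact fun v _ h => vertex_mul_of_ne K E h
    | edge f =>
      rw [Finset.sum_mul, Finset.mul_sum, Finset.sum_eq_single_of_mem (E.s f) (Finset.mem_univ _),
        Finset.sum_eq_single_of_mem (E.r f) (Finset.mem_univ _)]
      · exact ⟨source_mul_edge K E f, edge_mul_range K E f⟩
      · exact fun v _ h => edge_mul_vertex_of_ne K E h.symm
      · exact fun v _ h => vertex_mul_edge_of_ne K E h
    | ghost f =>
      rw [Finset.sum_mul, Finset.mul_sum, Finset.sum_eq_single_of_mem (E.r f) (Finset.mem_univ _),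
        Finset.sum_eq_single_of_mem (E.s f) (Finset.mem_univ _)]
      · exact ⟨range_mul_ghost K E f, ghost_mul_source K E f⟩
      · exact fun v _ h => ghost_mul_vertex_of_ne K E h.symm
      · exact fun v _ h => vertex_mul_ghost_of_ne K E h
    | add x y hx hy => rw [mul_add, add_mul, hx.1, hx.2, hy.1, hy.2]; simp
    | smul k x hx => rw [mul_smul_comm, smul_mul_assoc, hx.1, hx.2]; simp
    | mul x y hx hy => rw [← mul_assoc, hx.1, mul_assoc, hy.2]; simp
  exact ⟨fun a => (h a).1, fun a => (h a).2⟩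

/-- The products of edges with the vertex `w`. -/
inductive IsPathTo (w : V) : LeavittPathAlgebra K E → Prop
  | nil : IsPathTo w (vertex K E w)
  | cons (f : A) (x : LeavittPathAlgebra K E) : IsPathTo w x → IsPathTo w (edge K E f * x)

variable {K E}

/-- Only the first factor matters. Products of edges that do not compose are allowed in `IsPathTo`;
they are zero and do no harm. -/
theorem IsPathTo.vertex_mul {w : V} {x : LeavittPathAlgebra K E} (hx : IsPathTo K E w x) (v : V) :
    vertex K E v * x = x ∨ vertex K E v * x = 0 := by
  cases hx with
  | nil =>
    by_cases h : v = w
    · subst h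
      exact .inl (vertex_mul_self K E v)
    · exact .inr (vertex_mul_of_ne K E h)
  | cons f y _ =>
    by_cases h : v = E.s f
    · subst h
      exact .inl (by rw [← mul_assoc, source_mul_edge])
    · exact .inr (by rw [← mul_assoc, vertex_mul_edge_of_ne K E h, zero_mul])

/-- The left ideal generated by a sink is spanned by the paths that end there. -/
theorem mul_mem_span_isPathTo {w : V} (hw : ∀ f, E.s f ≠ w) (y : LeavittPathAlgebra K E) :
    ∀ x ∈ Submodule.span K {x | IsPathTo K E w x},
      y * x ∈ Submodule.span K {x | IsPathTo K E w x} := by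
  have aux (y : LeavittPathAlgebra K E)
      (h : ∀ x, IsPathTo K E w x → y * x ∈ Submodule.span K {x | IsPathTo K E w x}) :
      ∀ x ∈ Submodule.span K {x | IsPathTo K E w x},
        y * x ∈ Submodule.span K {x | IsPathTo K E w x} := by
    intro x hx
    induction hx using Submodule.span_induction with
    | mem x hx => exact h x hx
    | zero => simp
    | add a b _ _ ha hb =>
      rw [mul_add]
      exact add_mem ha hb
    | smul k a _ ha =>
      rw [mul_smul_comm]
      exact Submodule.smul_mem _ _ ha
  have hvertex (v : V) (x) (hx : IsPathTo K E w x) :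
      vertex K E v * x ∈ Submodule.span K {x | IsPathTo K E w x} := by
    rcases hx.vertex_mul v with h | h <;> rw [h]
    · exact Submodule.subset_span hx
    · exact zero_mem _
  induction y using induction_on with
  | zero => simp
  | vertex v => exact aux _ (hvertex v)
  | edge f => exact aux _ fun x hx => Submodule.subset_span (.cons f x hx)
  | ghost f =>
    refine aux _ fun x hx => ?_
    cases hx with
    | nil =>
      -- The sink hypothesis enters here: no ghost edge can start cancelling at `w`.
      rw [ghost_mul_vertex_of_ne K E (hw f)]
      exact zero_mem _
    | cons g x hx =>
      rw [← mul_assoc]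
      by_cases h : f = g
      · subst h
        rw [ghost_mul_edge_self]
        exact hvertex _ x hx
      · rw [ghost_mul_edge_of_ne K E h, zero_mul]
        exact zero_mem _
  | add a b ha hb =>
    intro x hx
    rw [add_mul]
    exact add_mem (ha x hx) (hb x hx)
  | smul k a ha =>
    intro x hx
    rw [smul_mul_assoc]
    exact Submodule.smul_mem _ _ (ha x hx)
  | mul a b ha hb =>
    intro x hx
    rw [mul_assoc]
    exact ha _ (hb x hx)

/-- A product in the span that begins with an edge is killed on the left by the sink `v`, so only
the trivial path contributes. -/
theorem sink_mul_sink_mem_span {v w : V} (hv : ∀ f, E.s f ≠ v) (hw : ∀ f, E.s f ≠ w)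
    (y : LeavittPathAlgebra K E) :
    ∃ k : K, vertex K E v * (y * vertex K E w) = k • vertex K E w := by
  have hy := mul_mem_span_isPathTo hw y _ (Submodule.subset_span (IsPathTo.nil (w := w)))
  generalize y * vertex K E w = x at hy ⊢
  induction hy using Submodule.span_induction with
  | mem x hx =>
    cases hx with
    | nil =>
      rcases (IsPathTo.nil (K := K) (E := E) (w := w)).vertex_mul v with h | h
      · exact ⟨1, by rw [h, one_smul]⟩
      · exact ⟨0, by rw [h, zero_smul]⟩
    | cons f x _ =>
      exact ⟨0, by rw [← mul_assoc, vertex_mul_edge_of_ne K E (hv f).symm, zero_mul, zero_smul]⟩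
  | zero => exact ⟨0, by simp⟩
  | add a b _ _ ha hb =>
    obtain ⟨k, hk⟩ := ha
    obtain ⟨l, hl⟩ := hb
    exact ⟨k + l, by rw [mul_add, hk, hl, add_smul]⟩
  | smul l a _ ha =>
    obtain ⟨k, hk⟩ := ha
    exact ⟨l * k, by rw [mul_smul_comm, hk, mul_smul]⟩

/-- Descent on `v`: if `v` emits edges, expanding it as `∑ f f*` leaves some `f* y w ≠ 0`, which
starts at the lower vertex `r(f)`. At a sink the element is a nonzero multiple of `w` and can be
rescaled. -/
theorem exists_mul_eq_sink [Finite V] [Finite A] (hE : E.IsAcyclic) {w : V}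
    (hw : ∀ f, E.s f ≠ w) (v : V) (y : LeavittPathAlgebra K E)
    (hne : vertex K E v * (y * vertex K E w) ≠ 0) :
    ∃ z, z * (y * vertex K E w) = vertex K E w := by
  induction v using hE.wellFounded.induction generalizing y with
  | h v ih =>
    by_cases hv : ∀ f, E.s f ≠ v
    · obtain ⟨k, hk⟩ := sink_mul_sink_mem_span (K := K) hv hw y
      have hk0 : k ≠ 0 := by
        rintro rfl
        exact hne (by rw [hk, zero_smul])
      exact ⟨k⁻¹ • vertex K E v, by
        rw [smul_mul_assoc, hk, smul_smul, inv_mul_cancel₀ hk0, one_smul]⟩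
    · push Not at hv
      rw [vertex_eq_sum K E v (Set.toFinite _) hv, Finset.sum_mul] at hne
      obtain ⟨f, hf, hne⟩ := Finset.exists_ne_zero_of_sum_ne_zero hne
      obtain ⟨z, hz⟩ := ih (E.r f) ⟨f, by simpa using hf, rfl⟩ (ghost K E f * y) (by
        intro h0
        rw [← mul_assoc, ← mul_assoc, range_mul_ghost] at h0
        apply hne
        rw [mul_assoc, ← mul_assoc (ghost K E f), h0, mul_zero])
      exact ⟨z * ghost K E f, by rw [mul_assoc, ← mul_assoc (ghost K E f), hz]⟩

theorem isLeftMinimal_sink [Finite V] [Finite A] (hE : E.IsAcyclic) {w : V}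
    (hw : ∀ f, E.s f ≠ w) : IsLeftMinimal (vertex K E w) := by
  have := Fintype.ofFinite V
  intro y
  by_cases hy : y * vertex K E w = 0
  · exact .inl hy
  rw [← (isIdentity_sum_vertex K E).one_mul (y * vertex K E w), Finset.sum_mul] at hy
  obtain ⟨v, -, hv⟩ := Finset.exists_ne_zero_of_sum_ne_zero hy
  exact .inr (exists_mul_eq_sink hE hw v y hv)

theorem vertex_mem_socle [Finite V] [Finite A] (hE : E.IsAcyclic) (v : V) :
    vertex K E v ∈ socle (LeavittPathAlgebra K E) := by
  induction v using hE.wellFounded.induction with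
  | h v ih =>
    by_cases hv : ∀ f, E.s f ≠ v
    · exact AddSubgroup.subset_closure (isLeftMinimal_sink hE hv)
    · push Not at hv
      rw [vertex_eq_sum K E v (Set.toFinite _) hv]
      refine sum_mem fun f hf => ?_
      -- Writing `f f*` as `f r(f) f*` exposes the lower vertex between two factors, which the
      -- two-sided socle absorbs.
      rw [← edge_mul_range]
      exact mul_mem_socle _ _ (ih _ ⟨f, by simpa using hf, rfl⟩)

end LeavittPathAlgebra

/-! ### The equivalence. -/

theorem mainTheorem4 {K : Type w} [Field K] {V : Type u} {A : Type v} [Nonempty V]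
    (E : DirectedGraph V A) :
    List.TFAE
      [(Finite V ∧ Finite A) ∧ E.IsAcyclic,
       NonUnitalRing.IsLeftArtinian (LeavittPathAlgebra K E),
       NonUnitalRing.IsRightArtinian (LeavittPathAlgebra K E),
       NonUnitalRing.IsArtinian (LeavittPathAlgebra K E),
       NonUnitalRing.IsUnitalSemisimple (LeavittPathAlgebra K E)] := by
  have hV (v : V) :
      LeavittPathAlgebra.vertex K E v * LeavittPathAlgebra.vertex K E v ≠ 0 := by
    rw [LeavittPathAlgebra.vertex_mul_self]
    exact LeavittPathAlgebra.vertex_ne_zero K E v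
  have hA (f : A) :
      LeavittPathAlgebra.ghost K E f * LeavittPathAlgebra.edge K E f ≠ 0 := by
    rw [LeavittPathAlgebra.ghost_mul_edge_self]
    exact LeavittPathAlgebra.vertex_ne_zero K E _
  tfae_have 1 → 5 := by
    rintro ⟨⟨_, _⟩, hE⟩
    have := Fintype.ofFinite V
    have he := LeavittPathAlgebra.isIdentity_sum_vertex K E
    refine ⟨_, he, fun h => ?_, ?_⟩
    · obtain ⟨v⟩ := ‹Nonempty V›
      refine LeavittPathAlgebra.vertex_ne_zero K E v ?_
      rw [← he.one_mul (LeavittPathAlgebra.vertex K E v), h, zero_mul]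
    · let := he.ring
      exact NonUnitalRing.isSemisimpleRing_of_one_mem_socle
        (sum_mem fun v _ => LeavittPathAlgebra.vertex_mem_socle hE v)
  tfae_have 5 → 4 := fun h => h.isArtinian
  tfae_have 4 → 2 := fun h => h.1
  tfae_have 4 → 3 := fun h => h.2
  tfae_have 2 → 1 := fun h =>
    ⟨⟨h.finite (fun _ _ => LeavittPathAlgebra.vertex_mul_of_ne K E) hV,
      h.finite (fun _ _ => LeavittPathAlgebra.ghost_mul_edge_of_ne K E) hA⟩,
      LeavittPathAlgebra.isAcyclic_of_isLeftArtinian h⟩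
  tfae_have 3 → 1 := fun h =>
    ⟨⟨h.finite (fun _ _ => LeavittPathAlgebra.vertex_mul_of_ne K E) hV,
      h.finite (fun _ _ => LeavittPathAlgebra.ghost_mul_edge_of_ne K E) hA⟩,
      LeavittPathAlgebra.isAcyclic_of_isRightArtinian h⟩
  tfae_finish
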